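/- Let $\langle W,R\rangle$ be an $\mathsf{S4}$ frame, i.e. $R$ is a reflexive transitive relation on a countable set $W$. Let $w_0\in W$, and let $G$ be the group of automorphisms of $\langle W,R\rangle$ that fix $w_0$. Let $L$ be a finite set and let $\Omega=(\{0,1\}^L)^W$ carry the product $\sigma$-field; $G$ acts on $\Omega$ by $(\pi\cdot V)(w)=V(\pi^{-1}(w))$. Let $P$ be a probability measure on $\Omega$ that is modally exchangeable at $w_0$, i.e. invariant under every $\pi\in G$. Let $\mathcal O$ be the set of $G$-orbits in $\{w\in W: R(w_0,w)\}$, and assume that the action of $G$ on each $O\in\mathcal O$ has property (Ext): for all $m$ and all finite sets $F_1,\dots,F_m\subseteq O$ (pairwise disjoint) and $F'_1,\dots,F'_m\subseteq O$ (pairwise disjoint) with $|F_i|=|F'_i|$ for all $i$, there is $\pi\in G$ with $\pi(F_i)=F'_i$ for all $i$. Let $\mathcal F^G$ be the $\sigma$-field of measurable $A\subseteq\Omega$ such that, for every $\pi\in G$, the sets $\{V:\pi\cdot V\in A\}$ and $A$ differ by a $P$-null set. For $O\in\mathcal O$, call a random probability measure $\Lambda_O$ on $\{0,1\}^L$ (a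 measurable function of $V\in\Omega$) *directing for $O$* if the valuations $\{V(w)\}_{w\in O}$ are i.i.d. with law $\Lambda_O$ conditionally on $\Lambda_O$, and also conditionally on $\mathcal F^G$. Call a random element $X$ of a measurable space, defined on $\Omega$, *rigid on $O$* if it is $\mathcal F^G$-measurable and $X(\pi\cdot V)=X(V)$ for $P$-a.e. $V$, for every $\pi\in G$ with $\pi(O)=O$. Then for every $O\in\mathcal O$: 1. If $O$ is infinite or consists of a single world, then there exists a random probability measure $\Lambda_O$ that is directing for $O$. 2. Every random probability measure $\Lambda_O$ that is directing for $O$ is rigid on $O$. 3. (Bernoulli parameterization) Let $\Lambda_O$ be directing for $O$. If for every $w\in O$ the coordinates $V(w)_\ell$, $\ell\in L$, are conditionally independent given $\Lambda_O$, then there is a random vector $\Theta_O=(\Theta_{O,\ell})_{\ell\in L}\in[0,1]^L$, rigid on $O$, such that $$\Lambda_O=\bigotimes_{\ell\in L}\mathrm{Bernoulli}(\Theta_{O,\ell})\qquad P\text{-a.s.}$$ -/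

import Mathlib

open MeasureTheory ProbabilityTheory

namespace ModalExch

/-- An S4 frame: the accessibility relation is reflexive and transitive. -/
structure IsS4 {W : Type*} (R : W → W → Prop) : Prop where
  refl : ∀ w, R w w
  trans : ∀ u v w, R u v → R v w → R u w

/-- The stabilizer of the world `w₀` in the automorphism group `R ≃r R` of the frame. -/
def Stab {W : Type*} (R : W → W → Prop) (w₀ : W) : Subgroup (R ≃r R) :=
  MulAction.stabilizer (R ≃r R) w₀

/-- The set of orbits of the stabilizer of `w₀` in the accessible cluster of `w₀`. -/
def clusterOrbits {W : Type*} (R : W → W → Prop) (w₀ : W) : Set (Set W) :=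
  {O | ∃ v, R w₀ v ∧ O = {v' | ∃ π ∈ Stab R w₀, π v = v'}}

/-- The finite-support extension property (Ext) of the action of the stabilizer on `O`. -/
def HasExt {W : Type*} (R : W → W → Prop) (w₀ : W) (O : Set W) : Prop :=
  ∀ (m : ℕ) (F F' : Fin m → Set W),
    (∀ i, (F i).Finite ∧ F i ⊆ O) → (∀ i, (F' i).Finite ∧ F' i ⊆ O) →
    (Pairwise fun i j => Disjoint (F i) (F j)) → (Pairwise fun i j => Disjoint (F' i) (F' j)) →
    (∀ i, (F i).ncard = (F' i).ncard) →
    ∃ π ∈ Stab R w₀, ∀ i, π '' F i = F' i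

/-- The valuation space, with atoms `L`. It carries the product σ-algebra. -/
abbrev Valuation (W L : Type*) : Type _ := W → L → Bool

/-- The action of frame automorphisms on valuations. -/
def act {W L : Type*} {R : W → W → Prop} (π : R ≃r R) (V : Valuation W L) : Valuation W L :=
  fun w => V (π.symm w)

lemma measurable_act {W L : Type*} {R : W → W → Prop} (π : R ≃r R) :
    Measurable (act π : Valuation W L → Valuation W L) := by
  unfold act
  fun_prop

/-- Modal exchangeability at `w₀`. -/
def ModallyExchangeable {W L : Type*} (R : W → W → Prop) (w₀ : W)
    (P : Measure (Valuation W L)) : Prop :=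
  ∀ π ∈ Stab R w₀, ∀ A : Set (Valuation W L), MeasurableSet A → P (act π ⁻¹' A) = P A

/-- The σ-algebra of invariant events: those measurable events which each element of the stabilizer
of `w₀` preserves up to a `P`-null set. -/
def invariantSigma {W L : Type*} (R : W → W → Prop) (w₀ : W) (P : Measure (Valuation W L)) :
    MeasurableSpace (Valuation W L) where
  MeasurableSet' A := MeasurableSet A ∧ ∀ π ∈ Stab R w₀, act π ⁻¹' A =ᵐ[P] A
  measurableSet_empty := ⟨MeasurableSet.empty, fun _ _ => by simp⟩
  measurableSet_compl A hA := ⟨hA.1.compl, fun π hπ => by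
    simpa only [Set.preimage_compl] using (hA.2 π hπ).compl⟩
  measurableSet_iUnion f hf := ⟨MeasurableSet.iUnion fun i => (hf i).1, fun π hπ => by
    simpa only [Set.preimage_iUnion] using Filter.EventuallyEq.countable_iUnion
      fun i => (hf i).2 π hπ⟩

/-- Conditionally on `m`, the values `V w` for `w ∈ O` are i.i.d. with law `Λ V`: the conditional
probabilities of all finite-dimensional events are the corresponding products. -/
def CondIID {W L : Type*} (P : Measure (Valuation W L)) (m : MeasurableSpace (Valuation W L))
    (O : Set W) (Λ : Valuation W L → ProbabilityMeasure (L → Bool)) : Prop :=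
  ∀ (s : Finset W) (B : W → Set (L → Bool)), (s : Set W) ⊆ O → (∀ w ∈ s, MeasurableSet (B w)) →
    P⟦⋂ w ∈ s, {V : Valuation W L | V w ∈ B w} | m⟧
      =ᵐ[P] fun V => ∏ w ∈ s, (Λ V : Measure (L → Bool)).real (B w)

/-- `Λ` is a directing random measure for the orbit `O`: a random probability measure such that the
valuations on `O` are i.i.d. with law `Λ`, both given `Λ` and given the invariant σ-algebra. -/
structure IsDirecting {W L : Type*} (R : W → W → Prop) (w₀ : W) (P : Measure (Valuation W L))
    (O : Set W) (Λ : Valuation W L → ProbabilityMeasure (L → Bool)) : Prop where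
  measurable : Measurable Λ
  iid_given_self : CondIID P (MeasurableSpace.comap Λ inferInstance) O Λ
  iid_given_invariant : CondIID P (invariantSigma R w₀ P) O Λ

/-- Rigidity of a random element `X` attached to the orbit `O`. -/
def IsRigid {W L E : Type*} [MeasurableSpace E] (R : W → W → Prop) (w₀ : W)
    (P : Measure (Valuation W L)) (O : Set W) (X : Valuation W L → E) : Prop :=
  Measurable[invariantSigma R w₀ P] X ∧
    ∀ π ∈ Stab R w₀, π '' O = O → ∀ᵐ V ∂P, X (act π V) = X V

end ModalExch

/-! This is de Finetti's theorem proved in `L²`. On an infinite orbit, (Ext) makes the stabilizer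
transitive on tuples of distinct worlds, so the indicators of `V w ∈ B` have constant Gram entries.
Their averages over finite sets `T` then converge to some `g`, with an error depending only on the
size of `T`. Hence `g` is invariant, and measurable for the invariant σ-algebra
(`ae_act_eq_of_limit_average`). Transitivity fixing a finite set `s` lets `g` stand for the
indicator at any world outside `s` (`setIntegral_limit_average`). So conditional probabilities
factor one world at a time, and the directing measure is the conditional law at one world of the
orbit.

Rigidity holds because a directing measure agrees a.e. on each of the finitely many atoms with an
invariant conditional expectation. The Bernoulli parameters are the marginals of `Λ`: conditional
independence gives equality on atoms. -/

namespace ModalExch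

/-! ### Averages in a Hilbert space with constant Gram entries -/

section Hilbert

open scoped RealInnerProductSpace
open Filter Topology

variable {ι H : Type*} [NormedAddCommGroup H] [InnerProductSpace ℝ H]

/-- The average of the vectors `x i`, `i ∈ T`. -/
noncomputable def average (x : ι → H) (T : Finset ι) : H := (T.card : ℝ)⁻¹ • ∑ i ∈ T, x i

lemma inner_average_average [DecidableEq ι] {O : Set ι} {x : ι → H} {a b : ℝ}
    (ha : ∀ i ∈ O, ⟪x i, x i⟫ = a) (hb : ∀ i ∈ O, ∀ j ∈ O, i ≠ j → ⟪x i, x j⟫ = b)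
    {T U : Finset ι} (hT : (T : Set ι) ⊆ O) (hU : (U : Set ι) ⊆ O)
    (hT' : T.Nonempty) (hU' : U.Nonempty) :
    ⟪average x T, average x U⟫ =
      b + (a - b) * ((T.card : ℝ)⁻¹ * (U.card : ℝ)⁻¹ * (T ∩ U).card) := by
  have h : ∀ i ∈ T, ∀ j ∈ U, ⟪x i, x j⟫ = b + if i = j then a - b else 0 := by
    intro i hi j hj
    by_cases hij : i = j
    · subst hij
      rw [ha i (hT hi), if_pos rfl]
      ring
    · rw [hb i (hT hi) j (hU hj) hij, if_neg hij, add_zero]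
  have hc : (T.card : ℝ) ≠ 0 := by exact_mod_cast hT'.card_ne_zero
  have hd : (U.card : ℝ) ≠ 0 := by exact_mod_cast hU'.card_ne_zero
  have hs : ∑ i ∈ T, ∑ j ∈ U, ⟪x i, x j⟫ = T.card * U.card * b + (T ∩ U).card * (a - b) := by
    rw [Finset.sum_congr rfl fun i hi => Finset.sum_congr rfl (h i hi)]
    simp only [Finset.sum_add_distrib, Finset.sum_const, Finset.sum_ite_eq, nsmul_eq_mul,
      Finset.sum_ite_mem]
    ring
  rw [average, average, real_inner_smul_left, real_inner_smul_right, sum_inner]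
  simp only [inner_sum]
  rw [hs]
  field_simp

/-- The overlap of `T` and `U` only decreases the distance, so dropping its term gives a bound that
needs no disjointness. -/
lemma norm_average_sub_average_sq_le {O : Set ι} {x : ι → H} {a b : ℝ} (hab : b ≤ a)
    (ha : ∀ i ∈ O, ⟪x i, x i⟫ = a) (hb : ∀ i ∈ O, ∀ j ∈ O, i ≠ j → ⟪x i, x j⟫ = b)
    {T U : Finset ι} (hT : (T : Set ι) ⊆ O) (hU : (U : Set ι) ⊆ O)
    (hT' : T.Nonempty) (hU' : U.Nonempty) :
    ‖average x T - average x U‖ ^ 2 ≤ (a - b) * ((T.card : ℝ)⁻¹ + (U.card : ℝ)⁻¹) := by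
  classical
  rw [norm_sub_sq_real, ← real_inner_self_eq_norm_sq, ← real_inner_self_eq_norm_sq,
    inner_average_average ha hb hT hT hT' hT', inner_average_average ha hb hT hU hT' hU',
    inner_average_average ha hb hU hU hU' hU', Finset.inter_self, Finset.inter_self]
  have hc : (T.card : ℝ) ≠ 0 := by exact_mod_cast hT'.card_ne_zero
  have hd : (U.card : ℝ) ≠ 0 := by exact_mod_cast hU'.card_ne_zero
  have h1 : (T.card : ℝ)⁻¹ * (T.card : ℝ)⁻¹ * T.card = (T.card : ℝ)⁻¹ := by field_simp
  have h2 : (U.card : ℝ)⁻¹ * (U.card : ℝ)⁻¹ * U.card = (U.card : ℝ)⁻¹ := by field_simp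
  have h3 : 0 ≤ (a - b) * ((T.card : ℝ)⁻¹ * (U.card : ℝ)⁻¹ * (T ∩ U).card) :=
    mul_nonneg (sub_nonneg.2 hab) (by positivity)
  rw [h1, h2]
  linarith

/-- Averages over finite subsets of an infinite family of vectors with constant Gram entries
converge, uniformly in the size of the subset. -/
lemma exists_limit_average [CompleteSpace H] {O : Set ι} (hO : O.Infinite) {x : ι → H} {a b : ℝ}
    (ha : ∀ i ∈ O, ⟪x i, x i⟫ = a) (hb : ∀ i ∈ O, ∀ j ∈ O, i ≠ j → ⟪x i, x j⟫ = b) :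
    ∃ g : H, ∀ T : Finset ι, (T : Set ι) ⊆ O → T.Nonempty →
      ‖average x T - g‖ ^ 2 ≤ (a - b) * (T.card : ℝ)⁻¹ := by
  have hab : b ≤ a := by
    obtain ⟨i, hi, j, hj, hij⟩ := hO.nontrivial
    have h : 0 ≤ ‖x i - x j‖ ^ 2 := by positivity
    rw [norm_sub_sq_real, ← real_inner_self_eq_norm_sq, ← real_inner_self_eq_norm_sq,
      ha i hi, ha j hj, hb i hi j hj hij] at h
    linarith
  choose S hSO hSc using fun n : ℕ => hO.exists_subset_card_eq (n + 1)
  have hSn : ∀ n, (S n).Nonempty := fun n => Finset.card_pos.1 (by rw [hSc]; omega)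
  have hSc' : ∀ n, ((S n).card : ℝ)⁻¹ = 1 / ((n : ℝ) + 1) := fun n => by
    rw [hSc]; push_cast; rw [one_div]
  have hlim : Tendsto (fun n : ℕ => 1 / ((n : ℝ) + 1)) atTop (𝓝 0) :=
    tendsto_one_div_add_atTop_nhds_zero_nat
  have hcauchy : CauchySeq fun n => average x (S n) := by
    refine cauchySeq_of_le_tendsto_0
      (fun N : ℕ => √((a - b) * (1 / ((N : ℝ) + 1) + 1 / ((N : ℝ) + 1)))) ?_ ?_
    · intro n m N hn hm
      rw [dist_eq_norm]
      refine Real.le_sqrt_of_sq_le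
        ((norm_average_sub_average_sq_le hab ha hb (hSO n) (hSO m) (hSn n) (hSn m)).trans ?_)
      rw [hSc', hSc']
      refine mul_le_mul_of_nonneg_left (add_le_add ?_ ?_) (sub_nonneg.2 hab) <;>
      exact Nat.one_div_le_one_div (by assumption)
    · simpa using ((hlim.add hlim).const_mul (a - b)).sqrt
  obtain ⟨g, hg⟩ := cauchySeq_tendsto_of_complete hcauchy
  -- Comparing `T` with `S n` and letting `n` grow removes the second term of the bound.
  refine ⟨g, fun T hT hT' => ?_⟩
  refine le_of_tendsto_of_tendsto' ((hg.const_sub (average x T)).norm.pow 2)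
    (b := atTop) (g := fun n : ℕ => (a - b) * ((T.card : ℝ)⁻¹ + 1 / ((n : ℝ) + 1))) ?_
    fun n => ?_
  · simpa using (hlim.const_add ((T.card : ℝ)⁻¹)).const_mul (a - b)
  · rw [← hSc']
    exact norm_average_sub_average_sq_le hab ha hb hT (hSO n) hT' (hSn n)

/-- The condition characterizing the limit of averages determines it as the limit of a sequence. -/
lemma exists_tendsto_average {O : Set ι} (hO : O.Infinite) (x : ι → H) (C : ℝ) :
    ∃ S : ℕ → Finset ι, (∀ n, (S n : Set ι) ⊆ O ∧ (S n).Nonempty) ∧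
      ∀ g : H, (∀ T : Finset ι, (T : Set ι) ⊆ O → T.Nonempty →
        ‖average x T - g‖ ^ 2 ≤ C * (T.card : ℝ)⁻¹) →
        Tendsto (fun n => average x (S n)) atTop (𝓝 g) := by
  choose S hSO hSc using fun n : ℕ => hO.exists_subset_card_eq (n + 1)
  have hSn : ∀ n, (S n).Nonempty := fun n => Finset.card_pos.1 (by rw [hSc]; omega)
  refine ⟨S, fun n => ⟨hSO n, hSn n⟩, fun g hg => ?_⟩
  have hlim : Tendsto (fun n : ℕ => √(C * (1 / ((n : ℝ) + 1)))) atTop (𝓝 0) := by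
    simpa using ((tendsto_one_div_add_atTop_nhds_zero_nat (𝕜 := ℝ)).const_mul C).sqrt
  refine tendsto_iff_norm_sub_tendsto_zero.2
    (squeeze_zero (fun _ => norm_nonneg _) (fun n => Real.le_sqrt_of_sq_le ?_) hlim)
  refine (hg (S n) (hSO n) (hSn n)).trans_eq ?_
  rw [hSc]
  push_cast
  rw [one_div]

/-- A vector with constant inner products against the family has the same inner product against the
limit of its averages. -/
lemma inner_eq_of_forall_inner_eq {O : Set ι} (hO : O.Infinite) {x : ι → H} {C r : ℝ} {g y : H}
    (hg : ∀ T : Finset ι, (T : Set ι) ⊆ O → T.Nonempty →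
      ‖average x T - g‖ ^ 2 ≤ C * (T.card : ℝ)⁻¹)
    (hy : ∀ i ∈ O, ⟪y, x i⟫ = r) : ⟪y, g⟫ = r := by
  obtain ⟨S, hS, h⟩ := exists_tendsto_average hO x C
  refine tendsto_nhds_unique ((tendsto_const_nhds (x := y)).inner (h g hg))
    (tendsto_const_nhds.congr fun n => ?_)
  have hc : ((S n).card : ℝ) ≠ 0 := by exact_mod_cast (hS n).2.card_ne_zero
  rw [average, real_inner_smul_right, inner_sum,
    Finset.sum_congr rfl fun i hi => hy i ((hS n).1 hi)]
  simp [hc]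

lemma eq_of_norm_average_sub_sq_le {O : Set ι} (hO : O.Infinite) {x : ι → H} {C : ℝ} {g g' : H}
    (hg : ∀ T : Finset ι, (T : Set ι) ⊆ O → T.Nonempty →
      ‖average x T - g‖ ^ 2 ≤ C * (T.card : ℝ)⁻¹)
    (hg' : ∀ T : Finset ι, (T : Set ι) ⊆ O → T.Nonempty →
      ‖average x T - g'‖ ^ 2 ≤ C * (T.card : ℝ)⁻¹) : g = g' := by
  obtain ⟨S, -, h⟩ := exists_tendsto_average hO x C
  exact tendsto_nhds_unique (h g hg) (h g' hg')

end Hilbert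

end ModalExch

/-! ### Almost invariant functions and rigidity -/

namespace ModalExch

variable {W L : Type*} {R : W → W → Prop} {w₀ : W} {P : Measure (Valuation W L)}

lemma ModallyExchangeable.measurePreserving_act (hP : ModallyExchangeable R w₀ P) {π : R ≃r R}
    (hπ : π ∈ Stab R w₀) : MeasurePreserving (act π : Valuation W L → Valuation W L) P P where
  measurable := measurable_act π
  map_eq := Measure.ext fun A hA => by rw [Measure.map_apply (measurable_act π) hA, hP π hπ A hA]

lemma invariantSigma_le : invariantSigma R w₀ P ≤ (inferInstance : MeasurableSpace (Valuation W L)) :=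
  fun _ hA => hA.1

/-- Invariance of events is required only up to null sets, so an a.e. invariant map is itself
measurable, without passing to a version. -/
lemma measurable_invariantSigma {E : Type*} [MeasurableSpace E] {X : Valuation W L → E}
    (hX : Measurable X) (h : ∀ π ∈ Stab R w₀, ∀ᵐ V ∂P, X (act π V) = X V) :
    Measurable[invariantSigma R w₀ P] X := fun A hA => by
  refine ⟨hX hA, fun π hπ => ?_⟩
  filter_upwards [h π hπ] with V hV
  change (X (act π V) ∈ A) = (X V ∈ A)
  rw [hV]

/-- Countably many rational sublevel sets determine `f`, so one null set suffices. -/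
lemma ae_act_eq_of_measurable_invariantSigma {f : Valuation W L → ℝ}
    (hf : Measurable[invariantSigma R w₀ P] f) {π : R ≃r R} (hπ : π ∈ Stab R w₀) :
    ∀ᵐ V ∂P, f (act π V) = f V := by
  have h : ∀ᵐ V ∂P, ∀ q : ℚ, f (act π V) < q ↔ f V < q := by
    refine ae_all_iff.2 fun q => ?_
    filter_upwards [(hf (measurableSet_Iio (a := (q : ℝ)))).2 π hπ] with V hV
    exact iff_of_eq hV
  filter_upwards [h] with V hV
  by_contra hne
  rcases lt_or_gt_of_ne hne with hlt | hlt
  · obtain ⟨q, h1, h2⟩ := exists_rat_btwn hlt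
    exact absurd ((hV q).1 h1) (not_lt.2 h2.le)
  · obtain ⟨q, h1, h2⟩ := exists_rat_btwn hlt
    exact absurd ((hV q).2 h1) (not_lt.2 h2.le)

lemma isRigid_of_ae_invariant {E : Type*} [MeasurableSpace E] {O : Set W} {X : Valuation W L → E}
    (hX : Measurable X) (h : ∀ π ∈ Stab R w₀, ∀ᵐ V ∂P, X (act π V) = X V) :
    IsRigid R w₀ P O X :=
  ⟨measurable_invariantSigma hX h, fun π hπ _ => h π hπ⟩

lemma CondIID.condExp_single {m : MeasurableSpace (Valuation W L)} {O : Set W}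
    {Λ : Valuation W L → ProbabilityMeasure (L → Bool)} (h : CondIID P m O Λ) {w : W} (hw : w ∈ O)
    {B : Set (L → Bool)} (hB : MeasurableSet B) :
    P⟦{V : Valuation W L | V w ∈ B} | m⟧ =ᵐ[P] fun V => (Λ V : Measure (L → Bool)).real B := by
  simpa using h {w} (fun _ => B) (by simpa using hw) (fun _ _ => hB)

lemma IsDirecting.ae_act_eq [Finite L] (hP : ModallyExchangeable R w₀ P) {O : Set W}
    (hO : O.Nonempty) {Λ : Valuation W L → ProbabilityMeasure (L → Bool)}
    (hΛ : IsDirecting R w₀ P O Λ) {π : R ≃r R} (hπ : π ∈ Stab R w₀) :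
    ∀ᵐ V ∂P, Λ (act π V) = Λ V := by
  obtain ⟨w, hw⟩ := hO
  have h : ∀ᵐ V ∂P, ∀ x : L → Bool,
      (Λ (act π V) : Measure (L → Bool)).real {x} = (Λ V : Measure (L → Bool)).real {x} := by
    refine ae_all_iff.2 fun x => ?_
    have h1 := hΛ.iid_given_invariant.condExp_single hw (measurableSet_singleton x)
    have h2 := ae_act_eq_of_measurable_invariantSigma
      (stronglyMeasurable_condExp (μ := P) (m := invariantSigma R w₀ P)
        (f := {V : Valuation W L | V w ∈ ({x} : Set (L → Bool))}.indicator
          fun _ => (1 : ℝ))).measurable hπ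
    -- `act π` preserves `P`, so the a.e. identity `h1` also holds at `act π V`.
    filter_upwards [h1, h2, (hP.measurePreserving_act hπ).quasiMeasurePreserving.ae h1]
      with V e1 e2 e3
    rw [← e1, ← e3, e2]
  filter_upwards [h] with V hV
  have heq : (Λ (act π V) : Measure (L → Bool)) = (Λ V : Measure (L → Bool)) :=
    Measure.ext_of_singleton fun x =>
      (measureReal_eq_measureReal_iff (measure_ne_top _ _) (measure_ne_top _ _)).1 (hV x)
  exact Subtype.ext heq

lemma IsDirecting.isRigid [Finite L] (hP : ModallyExchangeable R w₀ P) {O : Set W}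
    (hO : O.Nonempty) {Λ : Valuation W L → ProbabilityMeasure (L → Bool)}
    (hΛ : IsDirecting R w₀ P O Λ) : IsRigid R w₀ P O Λ :=
  isRigid_of_ae_invariant hΛ.measurable fun _ hπ => hΛ.ae_act_eq hP hO hπ

/-! ### Bernoulli parameterization -/

/-- The vector of marginal success probabilities of a random law on `L → Bool`. -/
noncomputable def marginals (μ : ProbabilityMeasure (L → Bool)) (l : L) : unitInterval :=
  ⟨(μ : Measure (L → Bool)).real {x | x l = true}, measureReal_nonneg, measureReal_le_one⟩

lemma measurableSet_apply_eq (l : L) (b : Bool) : MeasurableSet {x : L → Bool | x l = b} :=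
  (measurable_pi_apply (X := fun _ : L => Bool) l) (measurableSet_singleton b)

lemma measurable_marginals : Measurable (marginals (L := L)) := by
  refine measurable_pi_lambda _ fun l => Measurable.subtype_mk ?_
  exact ((Measure.measurable_coe (measurableSet_apply_eq l true)).comp measurable_subtype_coe).ennreal_toReal

lemma real_bernoulliMeasure_marginals (μ : ProbabilityMeasure (L → Bool)) (l : L) (b : Bool) :
    (bernoulliMeasure true false (marginals μ l)).real {b} =
      (μ : Measure (L → Bool)).real {x | x l = b} := by
  classical
  rw [bernoulliMeasure_real_apply _ (measurableSet_singleton b)]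
  cases b
  · have hc : {x : L → Bool | x l = false} = {x | x l = true}ᶜ := by ext; simp
    rw [hc, probReal_compl_eq_one_sub (measurableSet_apply_eq l true)]
    simp [marginals]
  · simp [marginals]

lemma eq_pi_bernoulli_of_real_singleton [Fintype L] (μ : ProbabilityMeasure (L → Bool))
    (h : ∀ x : L → Bool, (μ : Measure (L → Bool)).real {x} =
      ∏ l, (μ : Measure (L → Bool)).real {y | y l = x l}) :
    (μ : Measure (L → Bool)) = Measure.pi fun l => bernoulliMeasure true false (marginals μ l) := by
  refine Measure.ext_of_singleton fun x => (measureReal_eq_measureReal_iff).1 ?_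
  rw [h x, measureReal_def, Measure.pi_singleton, ENNReal.toReal_prod]
  exact Finset.prod_congr rfl fun l _ => (real_bernoulliMeasure_marginals μ l (x l)).symm

lemma IsDirecting.exists_bernoulli [Countable W] [Fintype L] [IsProbabilityMeasure P]
    (hP : ModallyExchangeable R w₀ P) {O : Set W} {w : W} (hw : w ∈ O)
    {Λ : Valuation W L → ProbabilityMeasure (L → Bool)} (hΛ : IsDirecting R w₀ P O Λ)
    (hind : iCondIndepFun (MeasurableSpace.comap Λ inferInstance) hΛ.measurable.comap_le
      (fun (l : L) (V : Valuation W L) => V w l) P) :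
    ∃ Θ : Valuation W L → L → unitInterval, IsRigid R w₀ P O Θ ∧
      ∀ᵐ V ∂P, (Λ V : Measure (L → Bool)) =
        Measure.pi fun l => bernoulliMeasure true false (Θ V l) := by
  refine ⟨fun V => marginals (Λ V),
    isRigid_of_ae_invariant (measurable_marginals.comp hΛ.measurable) fun π hπ => ?_, ?_⟩
  · filter_upwards [hΛ.ae_act_eq hP ⟨w, hw⟩ hπ] with V hV
    rw [hV]
  rw [iCondIndepFun_iff_condExp_inter_preimage_eq_mul _ _ (fun l => by fun_prop)] at hind
  have h : ∀ᵐ V ∂P, ∀ x : L → Bool, (Λ V : Measure (L → Bool)).real {x} =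
      ∏ l, (Λ V : Measure (L → Bool)).real {y | y l = x l} := by
    refine ae_all_iff.2 fun x => ?_
    have h1 := hΛ.iid_given_self.condExp_single hw (measurableSet_singleton x)
    have h2 : ∀ᵐ V ∂P, ∀ l : L, (P⟦{V : Valuation W L | V w ∈ {y : L → Bool | y l = x l}} |
        MeasurableSpace.comap Λ inferInstance⟧) V =
        (Λ V : Measure (L → Bool)).real {y | y l = x l} := ae_all_iff.2 fun l =>
      hΛ.iid_given_self.condExp_single hw (measurableSet_apply_eq l (x l))
    have h3 := hind Finset.univ (sets := fun l => {x l}) fun l _ => measurableSet_singleton (x l)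
    have hset : ⋂ l ∈ (Finset.univ : Finset L), (fun V : Valuation W L => V w l) ⁻¹' {x l} =
        {V : Valuation W L | V w ∈ ({x} : Set (L → Bool))} := by
      ext V
      simp [funext_iff]
    rw [hset] at h3
    filter_upwards [h1, h2, h3] with V e1 e2 e3
    rw [← e1, e3, Finset.prod_apply]
    exact Finset.prod_congr rfl fun l _ => e2 l
  filter_upwards [h] with V hV
  exact eq_pi_bernoulli_of_real_singleton (Λ V) hV

end ModalExch

/-! ### De Finetti's factorization on an infinite orbit -/

namespace ModalExch

open scoped RealInnerProductSpace

variable {W L : Type*} {R : W → W → Prop} {w₀ : W} {P : Measure (Valuation W L)} {O : Set W}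

/-- Singleton blocks turn (Ext) into transitivity on tuples of distinct worlds. -/
lemma HasExt.exists_apply_eq (hExt : HasExt R w₀ O) {m : ℕ} {e e' : Fin m → W}
    (he : e.Injective) (he' : e'.Injective) (heO : ∀ i, e i ∈ O) (heO' : ∀ i, e' i ∈ O) :
    ∃ π ∈ Stab R w₀, ∀ i, π (e i) = e' i := by
  obtain ⟨π, hπ, h⟩ := hExt m (fun i => {e i}) (fun i => {e' i})
    (fun i => ⟨Set.finite_singleton _, by simpa using heO i⟩)
    (fun i => ⟨Set.finite_singleton _, by simpa using heO' i⟩)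
    (fun i j hij => by simpa using fun h => hij (he h))
    (fun i j hij => by simpa using fun h => hij (he' h)) (fun i => by simp)
  exact ⟨π, hπ, fun i => by simpa using h i⟩

lemma HasExt.exists_fix_apply_eq (hExt : HasExt R w₀ O) {s : Finset W} (hs : (s : Set W) ⊆ O)
    {v u : W} (hv : v ∈ O) (hvs : v ∉ s) (hu : u ∈ O) (hus : u ∉ s) :
    ∃ π ∈ Stab R w₀, (∀ w ∈ s, π w = w) ∧ π v = u := by
  -- The tuples compared are `v` and `u`, each followed by the same enumeration of `s`.
  have key : ∀ z : W, z ∉ s →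
      Function.Injective (Fin.cons z (fun i => (s.equivFin.symm i : W)) : Fin (s.card + 1) → W) :=
    fun z hz => Fin.cons_injective_iff.2
      ⟨by rintro ⟨i, rfl⟩; exact hz (s.equivFin.symm i).2,
        Subtype.val_injective.comp s.equivFin.symm.injective⟩
  have keyO : ∀ z ∈ O, ∀ i,
      (Fin.cons z (fun i => (s.equivFin.symm i : W)) : Fin (s.card + 1) → W) i ∈ O :=
    fun z hz => Fin.cases hz fun i => hs (s.equivFin.symm i).2
  obtain ⟨π, hπ, h⟩ := hExt.exists_apply_eq (key v hvs) (key u hus) (keyO v hv) (keyO u hu)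
  refine ⟨π, hπ, fun w hw => ?_, by simpa using h 0⟩
  simpa using h (s.equivFin ⟨w, hw⟩).succ

lemma apply_mem_of_mem_clusterOrbits (hO : O ∈ clusterOrbits R w₀) {π : R ≃r R}
    (hπ : π ∈ Stab R w₀) {w : W} (hw : w ∈ O) : π w ∈ O := by
  obtain ⟨v, -, rfl⟩ := hO
  obtain ⟨ρ, hρ, rfl⟩ := hw
  exact ⟨π * ρ, mul_mem hπ hρ, rfl⟩

lemma nonempty_of_mem_clusterOrbits (hO : O ∈ clusterOrbits R w₀) : O.Nonempty := by
  obtain ⟨v, -, rfl⟩ := hO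
  exact ⟨v, 1, one_mem _, rfl⟩

lemma measurableSet_apply_mem (w : W) {B : Set (L → Bool)} (hB : MeasurableSet B) :
    MeasurableSet {V : Valuation W L | V w ∈ B} :=
  (measurable_pi_apply (X := fun _ : W => L → Bool) w) hB

lemma act_preimage_apply_mem (π : R ≃r R) (w : W) (B : Set (L → Bool)) :
    act π ⁻¹' {V : Valuation W L | V (π w) ∈ B} = {V | V w ∈ B} := by
  ext V
  simp [act]

/-- The indicator of the event `V w ∈ B`, as an element of `L²`. -/
noncomputable def indicatorLp (P : Measure (Valuation W L)) [IsProbabilityMeasure P]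
    {B : Set (L → Bool)} (hB : MeasurableSet B) (w : W) : Lp ℝ 2 P :=
  indicatorConstLp 2 (measurableSet_apply_mem w hB) (measure_ne_top P _) 1

variable [IsProbabilityMeasure P]

/-- Composition with `act π` is an isometry of `L²` that permutes the indicators. -/
lemma compMeasurePreserving_indicatorLp (hP : ModallyExchangeable R w₀ P) {π : R ≃r R}
    (hπ : π ∈ Stab R w₀) {B : Set (L → Bool)} (hB : MeasurableSet B) (w : W) :
    Lp.compMeasurePreserving (act π) (hP.measurePreserving_act hπ) (indicatorLp P hB (π w)) =
      indicatorLp P hB w := by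
  unfold indicatorLp
  rw [Lp.indicatorConstLp_compMeasurePreserving]
  congr 1
  exact act_preimage_apply_mem π w B

lemma inner_indicatorLp_apply (hP : ModallyExchangeable R w₀ P) {π : R ≃r R}
    (hπ : π ∈ Stab R w₀) {B : Set (L → Bool)} (hB : MeasurableSet B) (u v : W) :
    ⟪indicatorLp P hB (π u), indicatorLp P hB (π v)⟫ =
      ⟪indicatorLp P hB u, indicatorLp P hB v⟫ := by
  rw [← compMeasurePreserving_indicatorLp hP hπ hB u, ← compMeasurePreserving_indicatorLp hP hπ hB v]
  let U : Lp ℝ 2 P →ₗᵢ[ℝ] Lp ℝ 2 P :=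
    Lp.compMeasurePreservingₗᵢ ℝ (act π) (hP.measurePreserving_act hπ)
  exact (U.inner_map_map _ _).symm

lemma exists_limit_average_indicatorLp (hP : ModallyExchangeable R w₀ P) (hExt : HasExt R w₀ O)
    (hO : O.Infinite) {B : Set (L → Bool)} (hB : MeasurableSet B) :
    ∃ (g : Lp ℝ 2 P) (C : ℝ), ∀ T : Finset W, (T : Set W) ⊆ O → T.Nonempty →
      ‖average (indicatorLp P hB) T - g‖ ^ 2 ≤ C * (T.card : ℝ)⁻¹ := by
  obtain ⟨u, hu, v, hv, huv⟩ := hO.nontrivial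
  obtain ⟨g, hg⟩ := exists_limit_average hO (x := indicatorLp P hB)
    (a := ⟪indicatorLp P hB u, indicatorLp P hB u⟫) (b := ⟪indicatorLp P hB u, indicatorLp P hB v⟫)
    (fun i hi => by
      obtain ⟨π, hπ, -, h⟩ := hExt.exists_fix_apply_eq (s := ∅) (by simp) hu (by simp) hi (by simp)
      rw [← h, inner_indicatorLp_apply hP hπ])
    (fun i hi j hj hij => by
      obtain ⟨π, hπ, h⟩ := hExt.exists_apply_eq (e := ![u, v]) (e' := ![i, j])
        (by simpa [Function.Injective, Fin.forall_fin_two] using ⟨huv, huv.symm⟩)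
        (by simpa [Function.Injective, Fin.forall_fin_two] using ⟨hij, hij.symm⟩)
        (by simp [Fin.forall_fin_two, hu, hv]) (by simp [Fin.forall_fin_two, hi, hj])
      have h0 : π u = i := h 0
      have h1 : π v = j := h 1
      rw [← h0, ← h1, inner_indicatorLp_apply hP hπ])
  exact ⟨g, _, hg⟩

lemma ae_act_eq_of_limit_average (hP : ModallyExchangeable R w₀ P) (hO : O ∈ clusterOrbits R w₀)
    (hOinf : O.Infinite) {B : Set (L → Bool)} (hB : MeasurableSet B) {g : Lp ℝ 2 P} {C : ℝ}
    (hg : ∀ T : Finset W, (T : Set W) ⊆ O → T.Nonempty →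
      ‖average (indicatorLp P hB) T - g‖ ^ 2 ≤ C * (T.card : ℝ)⁻¹)
    {π : R ≃r R} (hπ : π ∈ Stab R w₀) : ∀ᵐ V ∂P, g (act π V) = g V := by
  set U := Lp.compMeasurePreservingₗᵢ (E := ℝ) (p := 2) ℝ (act π) (hP.measurePreserving_act hπ)
    with hU
  have hUx : ∀ w, U (indicatorLp P hB (π w)) = indicatorLp P hB w :=
    fun w => compMeasurePreserving_indicatorLp hP hπ hB w
  have hUg : U g = g := by
    -- `U` carries the average over the image of `T` under `π` to the average over `T`. The two sets
    -- have equal size, so `U g` satisfies the same bounds as `g`.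
    refine eq_of_norm_average_sub_sq_le hOinf (fun T hT hT' => ?_) hg
    have hav : average (indicatorLp P hB) T =
        U (average (indicatorLp P hB) (T.map π.toEquiv.toEmbedding)) := by
      simp only [average, map_smul, map_sum, Finset.card_map, Finset.sum_map]
      congr 1
      exact Finset.sum_congr rfl fun w _ => (hUx w).symm
    have h := hg (T.map π.toEquiv.toEmbedding) (fun w hw => by
      obtain ⟨z, hz, rfl⟩ := Finset.mem_map.1 hw
      exact apply_mem_of_mem_clusterOrbits hO hπ (hT hz)) (by simpa using hT')
    rwa [hav, ← map_sub, U.norm_map, ← Finset.card_map π.toEquiv.toEmbedding]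
  have h1 := Lp.coeFn_compMeasurePreserving g (hP.measurePreserving_act hπ)
  have h2 : Lp.compMeasurePreserving (act π) (hP.measurePreserving_act hπ) g = g := hUg
  rw [h2] at h1
  filter_upwards [h1] with V hV
  exact hV.symm

/-- An automorphism fixing `s` and taking `v` to `u` shows that `P (D ∩ {V u ∈ B})` is the same for
all `u ∈ O` outside `s`; the limit of averages over such `u` inherits this value. -/
lemma setIntegral_limit_average (hP : ModallyExchangeable R w₀ P) (hExt : HasExt R w₀ O)
    (hOinf : O.Infinite) {B : Set (L → Bool)} (hB : MeasurableSet B) {g : Lp ℝ 2 P} {C : ℝ}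
    (hg : ∀ T : Finset W, (T : Set W) ⊆ O → T.Nonempty →
      ‖average (indicatorLp P hB) T - g‖ ^ 2 ≤ C * (T.card : ℝ)⁻¹)
    {s : Finset W} (hs : (s : Set W) ⊆ O) {v : W} (hv : v ∈ O) (hvs : v ∉ s)
    {D : Set (Valuation W L)} (hD : MeasurableSet D)
    (hDs : ∀ π ∈ Stab R w₀, (∀ w ∈ s, π w = w) → act π ⁻¹' D =ᵐ[P] D) :
    ∫ V in D, g V ∂P = P.real (D ∩ {V | V v ∈ B}) := by
  rw [← L2.inner_indicatorConstLp_one hD (measure_ne_top P D) g]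
  refine inner_eq_of_forall_inner_eq (hOinf.sdiff s.finite_toSet)
    (fun T hT hT' => hg T (hT.trans Set.sdiff_subset) hT') fun u hu => ?_
  obtain ⟨π, hπ, hπs, hπv⟩ := hExt.exists_fix_apply_eq hs hv hvs hu.1 hu.2
  rw [indicatorLp, L2.real_inner_indicatorConstLp_one_indicatorConstLp_one hD
    (measurableSet_apply_mem u hB), measureReal_def, measureReal_def,
    ← hP π hπ _ (hD.inter (measurableSet_apply_mem u hB)), Set.preimage_inter, ← hπv,
    act_preimage_apply_mem]
  exact congrArg _ (measure_congr ((hDs π hπ hπs).inter (Filter.EventuallyEq.refl _ _)))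

/-- One step of de Finetti's factorization, given the invariant σ-algebra. -/
lemma exists_condExp_inter_eq_mul (hP : ModallyExchangeable R w₀ P)
    (hO : O ∈ clusterOrbits R w₀) (hExt : HasExt R w₀ O) (hOinf : O.Infinite)
    {B : Set (L → Bool)} (hB : MeasurableSet B) :
    ∃ g : Valuation W L → ℝ, ∀ (s : Finset W) (A : W → Set (L → Bool)) (v : W), (s : Set W) ⊆ O →
      (∀ w ∈ s, MeasurableSet (A w)) → v ∈ O → v ∉ s →
      P⟦{V : Valuation W L | V v ∈ B} ∩ ⋂ w ∈ s, {V : Valuation W L | V w ∈ A w} |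
          invariantSigma R w₀ P⟧
        =ᵐ[P] g * P⟦⋂ w ∈ s, {V : Valuation W L | V w ∈ A w} | invariantSigma R w₀ P⟧ := by
  obtain ⟨g, C, hg⟩ := exists_limit_average_indicatorLp hP hExt hOinf hB
  have hgm : Measurable[invariantSigma R w₀ P] g :=
    measurable_invariantSigma (Lp.stronglyMeasurable g).measurable
      fun π hπ => ae_act_eq_of_limit_average hP hO hOinf hB hg hπ
  have hgint : Integrable g P := (Lp.memLp g).integrable one_le_two
  refine ⟨g, fun s A v hs hA hv hvs => ?_⟩
  set E : Set (Valuation W L) := ⋂ w ∈ s, {V : Valuation W L | V w ∈ A w} with hE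
  have hEm : MeasurableSet E :=
    Finset.measurableSet_biInter s fun w hw => measurableSet_apply_mem w (hA w hw)
  have hEs : ∀ π ∈ Stab R w₀, (∀ w ∈ s, π w = w) → act π ⁻¹' E = E := by
    intro π _ hπs
    rw [hE, Set.preimage_iInter₂]
    refine Set.iInter₂_congr fun w hw => ?_
    conv_lhs => rw [← hπs w hw]
    conv_rhs => rw [← act_preimage_apply_mem π w (A w)]
    rw [hπs w hw]
  have hmul : (g : Valuation W L → ℝ) * E.indicator (fun _ => (1 : ℝ)) = E.indicator g := by
    ext V
    by_cases hV : V ∈ E <;> simp [hV]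
  have hpull := condExp_mul_of_stronglyMeasurable_left (μ := P) (m := invariantSigma R w₀ P)
    (f := g) (g := E.indicator fun _ => (1 : ℝ)) hgm.stronglyMeasurable
    (by rw [hmul]; exact hgint.indicator hEm) ((integrable_const 1).indicator hEm)
  refine Filter.EventuallyEq.trans ?_ hpull
  rw [hmul]
  -- It remains to compare integrals over invariant `D`. The set `D ∩ E` is still almost invariant
  -- under automorphisms fixing `s`, which is all that `setIntegral_limit_average` asks.
  refine (ae_eq_condExp_of_forall_setIntegral_eq invariantSigma_le (hgint.indicator hEm)
    (fun _ _ _ => integrable_condExp.integrableOn) (fun D hD _ => ?_)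
    stronglyMeasurable_condExp.aestronglyMeasurable)
  have hF : MeasurableSet ({V : Valuation W L | V v ∈ B} ∩ E) :=
    (measurableSet_apply_mem v hB).inter hEm
  rw [setIntegral_condExp invariantSigma_le ((integrable_const 1).indicator hF) hD,
    setIntegral_indicator hEm, setIntegral_indicator hF,
    setIntegral_limit_average hP hExt hOinf hB hg hs hv hvs (hD.1.inter hEm)
      fun π hπ hπs => ?_]
  · simp only [setIntegral_const, smul_eq_mul, mul_one]
    congr 1
    ext V
    simp only [Set.mem_inter_iff]
    tauto
  · rw [Set.preimage_inter, hEs π hπ hπs]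
    exact (hD.2 π hπ).inter (Filter.EventuallyEq.refl _ _)

/-! ### The conditional law as directing measure -/

/-- The conditional law of the valuation at `v` given the invariant σ-algebra. -/
noncomputable def conditionalLaw [Countable W] [Finite L] (R : W → W → Prop) (w₀ : W)
    (P : Measure (Valuation W L)) [IsProbabilityMeasure P] (v : W) (V : Valuation W L) :
    ProbabilityMeasure (L → Bool) :=
  ⟨(condExpKernel P (invariantSigma R w₀ P) V).map fun V' => V' v,
    Measure.isProbabilityMeasure_map (measurable_pi_apply v).aemeasurable⟩

section

variable [Countable W] [Finite L]

lemma measurable_conditionalLaw (v : W) :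
    Measurable[invariantSigma R w₀ P] (conditionalLaw R w₀ P v) := by
  refine Measurable.subtype_mk (Measure.measurable_of_measurable_coe _ fun B hB => ?_)
  have h := measurable_condExpKernel (μ := P) (m := invariantSigma R w₀ P)
    (measurableSet_apply_mem v hB)
  convert h using 2 with V
  exact Measure.map_apply (measurable_pi_apply v) hB

lemma real_conditionalLaw_ae_eq (v : W) {B : Set (L → Bool)} (hB : MeasurableSet B) :
    P⟦{V : Valuation W L | V v ∈ B} | invariantSigma R w₀ P⟧
      =ᵐ[P] fun V => (conditionalLaw R w₀ P v V : Measure (L → Bool)).real B := by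
  filter_upwards [condExpKernel_ae_eq_condExp (μ := P) invariantSigma_le
    (measurableSet_apply_mem v hB)] with V hV
  rw [← hV, measureReal_def, measureReal_def]
  exact congrArg _ (Measure.map_apply (measurable_pi_apply v) hB).symm

/-- By the tower property: the product of `Λ`-probabilities is already measurable for the smaller
σ-algebra generated by `Λ`. -/
lemma isDirecting_of_condIID {Λ : Valuation W L → ProbabilityMeasure (L → Bool)}
    (hΛ : Measurable[invariantSigma R w₀ P] Λ) (h : CondIID P (invariantSigma R w₀ P) O Λ) :
    IsDirecting R w₀ P O Λ where
  measurable := hΛ.mono invariantSigma_le le_rfl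
  iid_given_invariant := h
  iid_given_self s B hs hB := by
    have hle : MeasurableSpace.comap Λ inferInstance ≤ invariantSigma R w₀ P := hΛ.comap_le
    refine (condExp_condExp_of_le hle invariantSigma_le).symm.trans
      ((condExp_congr_ae (h s B hs hB)).trans ?_)
    have hm : ∀ w ∈ s, Measurable[MeasurableSpace.comap Λ inferInstance]
        fun V => (Λ V : Measure (L → Bool)).real (B w) := fun w hw =>
      ((Measure.measurable_coe (hB w hw)).comp measurable_subtype_coe).ennreal_toReal.comp
        (comap_measurable Λ)
    have hint : Integrable (fun V => ∏ w ∈ s, (Λ V : Measure (L → Bool)).real (B w)) P :=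
      (integrable_congr (h s B hs hB)).1 integrable_condExp
    rw [condExp_of_stronglyMeasurable (hle.trans invariantSigma_le)
      (Finset.measurable_prod s hm).stronglyMeasurable hint]

lemma condIID_singleton (v : W) :
    CondIID P (invariantSigma R w₀ P) {v} (conditionalLaw R w₀ P v) := by
  intro s B hs hB
  rcases Finset.subset_singleton_iff.1 (show s ⊆ {v} by exact_mod_cast hs) with rfl | rfl
  · simp [condExp_const invariantSigma_le]
  · simpa using real_conditionalLaw_ae_eq v (hB v (by simp))

lemma condIID_conditionalLaw (hP : ModallyExchangeable R w₀ P) (hO : O ∈ clusterOrbits R w₀)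
    (hExt : HasExt R w₀ O) (hOinf : O.Infinite) {v : W} (hv : v ∈ O) :
    CondIID P (invariantSigma R w₀ P) O (conditionalLaw R w₀ P v) := by
  classical
  intro s B hs hB
  induction s using Finset.induction_on with
  | empty =>
    simp [condExp_const invariantSigma_le]
  | insert u s hu ih =>
    rw [Finset.coe_insert, Set.insert_subset_iff] at hs
    have ih' := ih hs.2 fun w hw => hB w (Finset.mem_insert_of_mem hw)
    have hBu := hB u (Finset.mem_insert_self u s)
    obtain ⟨g, hg⟩ := exists_condExp_inter_eq_mul hP hO hExt hOinf hBu
    have h1 := hg s B u hs.2 (fun w hw => hB w (Finset.mem_insert_of_mem hw)) hs.1 hu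
    -- The function `g` depends on neither the world nor `s`; taking `s = ∅` at `v` identifies it
    -- with the conditional probability of `V v ∈ B u`.
    have h2 := hg ∅ B v (by simp) (by simp) hv (by simp)
    have h3 := real_conditionalLaw_ae_eq (R := R) (w₀ := w₀) (P := P) v hBu
    have h4 : P⟦(Set.univ : Set (Valuation W L)) | invariantSigma R w₀ P⟧ = fun _ => 1 := by
      simp only [Set.indicator_univ]
      exact condExp_const invariantSigma_le 1
    simp only [Finset.notMem_empty, Set.iInter_of_empty, Set.iInter_univ, Set.inter_univ] at h2
    rw [h4] at h2
    rw [Finset.set_biInter_insert]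
    filter_upwards [h1, h2, h3, ih'] with V e1 e2 e3 e4
    rw [e1, Finset.prod_insert hu, Pi.mul_apply, e4, ← e3, e2]
    simp

lemma exists_isDirecting (hP : ModallyExchangeable R w₀ P) (hO : O ∈ clusterOrbits R w₀)
    (hExt : HasExt R w₀ O) (h : O.Infinite ∨ ∃ v, O = {v}) :
    ∃ Λ : Valuation W L → ProbabilityMeasure (L → Bool), IsDirecting R w₀ P O Λ := by
  rcases h with h | ⟨v, rfl⟩
  · obtain ⟨v, hv⟩ := nonempty_of_mem_clusterOrbits hO
    exact ⟨_, isDirecting_of_condIID (measurable_conditionalLaw v)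
      (condIID_conditionalLaw hP hO hExt h hv)⟩
  · exact ⟨_, isDirecting_of_condIID (measurable_conditionalLaw v) (condIID_singleton v)⟩

end

end ModalExch

theorem mainTheorem3 {W L : Type*} [Countable W] [Fintype L] (R : W → W → Prop)
    (hR : ModalExch.IsS4 R) (w₀ : W) (P : Measure (ModalExch.Valuation W L))
    [IsProbabilityMeasure P] (hP : ModalExch.ModallyExchangeable R w₀ P)
    (hExt : ∀ O ∈ ModalExch.clusterOrbits R w₀, ModalExch.HasExt R w₀ O) :
    ∀ O ∈ ModalExch.clusterOrbits R w₀,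
      ((O.Infinite ∨ ∃ v, O = {v}) →
        ∃ Λ : ModalExch.Valuation W L → ProbabilityMeasure (L → Bool),
          ModalExch.IsDirecting R w₀ P O Λ) ∧
      ∀ (Λ : ModalExch.Valuation W L → ProbabilityMeasure (L → Bool))
        (hΛ : ModalExch.IsDirecting R w₀ P O Λ),
        ModalExch.IsRigid R w₀ P O Λ ∧
        ((∀ w ∈ O, iCondIndepFun (MeasurableSpace.comap Λ inferInstance)
            hΛ.measurable.comap_le (fun (l : L) (V : ModalExch.Valuation W L) => V w l) P) →
          ∃ Θ : ModalExch.Valuation W L → L → unitInterval,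
            ModalExch.IsRigid R w₀ P O Θ ∧
            ∀ᵐ V ∂P, (Λ V : Measure (L → Bool)) =
              Measure.pi fun l => bernoulliMeasure true false (Θ V l)) := by
  intro O hO
  have hne := ModalExch.nonempty_of_mem_clusterOrbits hO
  refine ⟨ModalExch.exists_isDirecting hP hO (hExt O hO), fun Λ hΛ =>
    ⟨hΛ.isRigid hP hne, fun hind => ?_⟩⟩
  obtain ⟨w, hw⟩ := hne
  exact hΛ.exists_bernoulli hP hw (hind w hw)
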